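/- **Setting.** Let $\Delta\subset\mathbb R^n$ be a simple integral polytope, i.e. a non-empty compact set $$\Delta=\bigcap_{i=1}^d\{x:\langle u_i,x\rangle+\mu_i\ge 0\},$$ an intersection in which no half-space can be left out, with primitive inward normals $u_i\in(\mathbb Z^n)^*$, whose vertices all lie in $\mathbb Z^n$ and such that every vertex lies on exactly $n$ facets. For a vertex $v$ let $I_v=\{i:\langle u_i,v\rangle+\mu_i=0\}$; let $\alpha_{i,v}$ ($i\in I_v$) be the basis of $\mathbb R^n$ dual to $u_i$ ($i\in I_v$), and let $\Gamma_v=(\mathbb Z^n)^*/\sum_{i\in I_v}\mathbb Z u_i$, a finite group. A polarizing vector is a $\xi\in(\mathbb R^n)^*$ with $\langle\xi,\alpha_{j,v}\rangle\neq0$ for all $v$ and all $j\in I_v$. Given $\xi$, put $\alpha^\sharp_{j,v}=\alpha_{j,v}$ and $u^\sharp_{j,v}=u_j$ if $\langle\xi,\alpha_{j,v}\rangle<0$, and $\alpha^\sharp_{j,v}=-\alpha_{j,v}$ and $u^\sharp_{j,v}=-u_j$ otherwise; let $\#v$ be the number of $j\in I_v$ with $\langle\xi,\alpha_{j,v}\rangle>0$,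 and put $\mathbf C_v^\sharp=v+\sum_{j\in I_v}\mathbb R_{\ge0}\,\alpha^\sharp_{j,v}$ and $\lambda^\sharp_{\gamma,j,v}=e^{2\pi i\langle\gamma,\alpha^\sharp_{j,v}\rangle}$ for $\gamma\in\Gamma_v$ (a well-defined root of unity). For a root of unity $\lambda$ of order $N_\lambda$ let $Q_{1,1}(x)=x-\lfloor x\rfloor-\tfrac12$ and $Q_{1,\lambda}(x)=\frac{\lambda}{1-\lambda}\lambda^{\lfloor x\rfloor}$ if $\lambda\ne1$, and for $m\ge1$ let $Q_{m+1,\lambda}$ be the antiderivative of $Q_{m,\lambda}$ with $\int_0^{N_\lambda}Q_{m+1,\lambda}(x)\,dx=0$. With the Bernoulli numbers $b_{2j}$ (so $b_0=1$), let $$\mathbf M^{k,1}(S)=\sum_{0\le j\le k/2}\frac{b_{2j}}{(2j)!}S^{2j},\qquad \mathbf M^{k,\lambda}(S)=\Bigl(\frac12+\frac{\lambda}{1-\lambda}\Bigr)S+\sum_{m=2}^kQ_{m,\lambda}(0)S^m\quad(\lambda\neq1).$$ For an integer $k\ge1$ and a polarizing vector $\xi$ the remainder is $$R^\Delta_k(f)=\sum_v(-1)^{\#v}\sum_{\gamma\in\Gamma_v}\sum_{I\subsetneq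 I_v}(-1)^{(k-1)(n-|I|)}\int_{\mathbf C_v^\sharp}\ \prod_{j\in I_v\smallsetminus I}Q_{k,\lambda^\sharp_{\gamma,j,v}}\bigl(\langle u^\sharp_{j,v},x-v\rangle\bigr)\ \prod_{j\in I}\mathbf M^{k,\lambda^\sharp_{\gamma,j,v}}\bigl(-D_{\alpha^\sharp_{j,v}}\bigr)\prod_{j\in I_v\smallsetminus I}\bigl(D_{\alpha^\sharp_{j,v}}\bigr)^kf(x)\,dx,$$ where $v$ runs over the vertices of $\Delta$ and $D_\alpha$ is the directional derivative; it is defined in the first place for compactly supported complex-valued $f$ of class $C^{nk}$. A symbol of order $N\in\mathbb R$ is a smooth $f:\mathbb R^n\to\mathbb C$ such that for every multi-index $a$ there is a constant $C_a$ with $|\partial^af(x)|\le C_a(1+|x|)^{N-|a|}$ for all $x\in\mathbb R^n$. **Proposition.** Let $\Delta\subset\mathbb R^n$ be a simple integral polytope and $k\ge1$. There is a constant $K=K(k,\Delta)\ge 0$ such that for every polarizing vector $\xi$: 1. If $f$ is compactly supported of class $C^{nk}$, then all the integrals in the formula for $R^\Delta_k(f)$ converge absolutely and $$|R^\Delta_k(f)|\le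 K\cdot\sup_{j\in\mathbb Z_{\ge0}^n,\ k\le|j|\le nk}\ \bigl\|\partial_1^{j_1}\cdots\partial_n^{j_n}f\bigr\|_{L^1(\mathbb R^n)}.\qquad(*)$$ 2. If $f$ is a symbol of order less than $k-n$, then all the integrals in the same formula still converge absolutely, so that $R_k^\Delta(f)$ is defined by it; the derivatives $\partial^jf$ with $k\le|j|\le nk$ are in $L^1(\mathbb R^n)$; and $(*)$ holds with the same $K$. 3. For each real $N<k-n$ the symbols of order $N$ form a complex vector space, and $R^\Delta_k$ is linear on it. -/

import Mathlib

open MeasureTheory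
open scoped ContDiff NNReal ENNReal

noncomputable section

namespace PolytopeEM

/-- Euclidean space `ℝⁿ`. -/
abbrev E (n : ℕ) := EuclideanSpace ℝ (Fin n)

/-- The pairing of an element `u` of the dual lattice `ℤⁿ*` with a vector `x` of `ℝⁿ`. -/
def pairing {n : ℕ} (u : Fin n → ℤ) (x : E n) : ℝ := ∑ l, (u l : ℝ) * x l

/-- The intersection of the half-spaces `⟨u i, x⟩ + μ i ≥ 0`. -/
def halfSpaces {n d : ℕ} (u : Fin d → Fin n → ℤ) (μ : Fin d → ℝ) : Set (E n) :=
  {x | ∀ i, 0 ≤ pairing (u i) x + μ i}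

/-- A simple integral polytope in `ℝⁿ`, presented (uniquely, up to the numbering of the facets)
as an irredundant intersection of half-spaces whose inward normals are primitive elements of the
dual lattice. -/
structure SimpleIntegralPolytope (n : ℕ) where
  /-- the number of facets -/
  d : ℕ
  /-- the primitive inward normals to the facets -/
  u : Fin d → Fin n → ℤ
  /-- the constants in the inequalities that define the half-spaces -/
  μ : Fin d → ℝ
  nonempty : (halfSpaces u μ).Nonempty
  compact : IsCompact (halfSpaces u μ)
  /-- no half-space can be left out -/
  irredundant : ∀ i, ∃ x : E n, pairing (u i) x + μ i < 0 ∧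
    ∀ j, j ≠ i → 0 ≤ pairing (u j) x + μ j
  /-- no normal is a multiple of a lattice element by an integer greater than one -/
  primitive : ∀ i (m : ℤ) (w : Fin n → ℤ), 1 < m → u i ≠ m • w
  /-- the vertices are lattice points -/
  integral : ∀ v ∈ (halfSpaces u μ).extremePoints ℝ, ∃ z : Fin n → ℤ, ∀ l, v l = z l
  /-- every vertex lies on exactly `n` facets -/
  simple : ∀ v ∈ (halfSpaces u μ).extremePoints ℝ,
    Nat.card {i : Fin d // pairing (u i) v + μ i = 0} = n

/-! ### Partial derivatives, differential operators, symbols -/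

/-- The partial derivative `∂ f / ∂ x_l`. -/
def partialDeriv {n : ℕ} (l : Fin n) (f : E n → ℂ) : E n → ℂ :=
  fun x => lineDeriv ℝ f x (EuclideanSpace.single l 1)

/-- The partial derivative `∂₁^{a₁} ⋯ ∂ₙ^{aₙ} f`. -/
def multiDeriv {n : ℕ} (a : Fin n → ℕ) (f : E n → ℂ) : E n → ℂ :=
  (List.finRange n).foldr (fun l g => (partialDeriv l)^[a l] g) f

/-- The differential operator `p(∂₁, …, ∂ₙ)` with constant coefficients given by a
polynomial `p`. -/
def diffOp {n : ℕ} (p : MvPolynomial (Fin n) ℂ) (f : E n → ℂ) (x : E n) : ℂ :=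
  ∑ a ∈ p.support, p.coeff a * multiDeriv a f x

/-- The linear polynomial `∑ a_l X_l`; under `X_l ↦ ∂_l` it becomes the directional
derivative `D_a`. -/
def dirSymbol {n : ℕ} (a : E n) : MvPolynomial (Fin n) ℂ :=
  ∑ l, MvPolynomial.C ((a l : ℝ) : ℂ) * MvPolynomial.X l

/-- Symbols of order `N`: smooth functions with
`|∂₁^{a₁} ⋯ ∂ₙ^{aₙ} f (x)| ≤ C_a (1 + |x|) ^ (N - |a|)` for all `a`. -/
def IsSymbol {n : ℕ} (N : ℝ) (f : E n → ℂ) : Prop :=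
  ContDiff ℝ ∞ f ∧ ∀ a : Fin n → ℕ, ∃ C : ℝ, ∀ x,
    ‖multiDeriv a f x‖ ≤ C * (1 + ‖x‖) ^ (N - ((∑ l, a l : ℕ) : ℝ))

/-! ### The periodic functions `Q_{m,z}` and the polynomials `M^{k,z}` -/

/-- For a root of unity `z` of order `N`: `Q_{1,1} (x) = x - ⌊x⌋ - 1/2`, and
`Q_{1,z} (x) = z / (1 - z) * z ^ ⌊x⌋` if `z ≠ 1`; each further `Q_{m+1,z}` is the antiderivative
of `Q_{m,z}` whose integral from `0` to `N` vanishes. The value at `m = 0` is not used. -/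
def Q (z : ℂ) : ℕ → ℝ → ℂ
  | 0 => fun _ => 0
  | 1 => fun x => if z = 1 then ((Int.fract x - 1 / 2 : ℝ) : ℂ) else z / (1 - z) * z ^ ⌊x⌋
  | m + 2 => fun x => (∫ t in (0 : ℝ)..x, Q z (m + 1) t) -
      (1 / (orderOf z : ℂ)) * ∫ s in (0 : ℝ)..(orderOf z : ℝ), ∫ t in (0 : ℝ)..s, Q z (m + 1) t

/-- `M^{k,1} (S) = ∑_{j ≤ k/2} b_{2j} / (2j)! S^{2j}` and, for `z ≠ 1`,
`M^{k,z} (S) = (1/2 + z / (1 - z)) S + ∑_{2 ≤ m ≤ k} Q_{m,z}(0) S^m`. -/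
def M (k : ℕ) (z : ℂ) : Polynomial ℂ :=
  if z = 1 then
    ∑ j ∈ Finset.range (k / 2 + 1),
      Polynomial.C (((bernoulli (2 * j) : ℚ) : ℂ) / ((2 * j).factorial : ℂ)) *
        Polynomial.X ^ (2 * j)
  else
    Polynomial.C (1 / 2 + z / (1 - z)) * Polynomial.X +
      ∑ m ∈ Finset.Icc 2 k, Polynomial.C (Q z m 0) * Polynomial.X ^ m

namespace SimpleIntegralPolytope

variable {n : ℕ} (P : SimpleIntegralPolytope n)

/-- The underlying set of the polytope. -/
def carrier : Set (E n) := halfSpaces P.u P.μ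

/-- The set of vertices. -/
def vertices : Set (E n) := P.carrier.extremePoints ℝ

/-- The set `I_v` of facets that contain `v`. -/
abbrev FacetsAt (v : E n) : Type := {i : Fin P.d // pairing (P.u i) v + P.μ i = 0}

instance (v : E n) : Fintype (P.FacetsAt v) := Fintype.ofFinite _

/-! ### Finiteness of the set of vertices, existence of the dual basis -/

theorem pairing_add (u : Fin n → ℤ) (x y : E n) :
    pairing u (x + y) = pairing u x + pairing u y := by
  simp [pairing, mul_add, Finset.sum_add_distrib]

theorem pairing_smul (u : Fin n → ℤ) (r : ℝ) (x : E n) :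
    pairing u (r • x) = r * pairing u x := by
  simp only [pairing, PiLp.smul_apply, smul_eq_mul, Finset.mul_sum]
  exact Finset.sum_congr rfl fun l _ => by ring

theorem eq_zero_of_pairing (v : P.vertices) (w : E n)
    (hw : ∀ i : P.FacetsAt v, pairing (P.u i) w = 0) : w = 0 := by
  obtain ⟨v, hv⟩ := v
  have hvP : ∀ i, 0 ≤ pairing (P.u i) v + P.μ i := hv.1
  have hev : ∀ᶠ r : ℝ in nhds 0, ∀ i, 0 ≤ pairing (P.u i) (v + r • w) + P.μ i := by
    rw [Filter.eventually_all]
    intro i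
    simp only [pairing_add, pairing_smul]
    by_cases hi : pairing (P.u i) v + P.μ i = 0
    · have := hw ⟨i, hi⟩
      simp only at this
      simp [this, hi]
    · have hpos : 0 < pairing (P.u i) v + P.μ i := lt_of_le_of_ne (hvP i) (Ne.symm hi)
      have hc : ContinuousAt (fun r : ℝ => pairing (P.u i) v + r * pairing (P.u i) w + P.μ i) 0 := by
        fun_prop
      have := hc.eventually (lt_mem_nhds (a := 0) (by simpa using hpos))
      exact this.mono fun r hr => hr.le
  obtain ⟨ε, hε, hball⟩ := Metric.eventually_nhds_iff.mp hev
  have h1 : v + (ε / 2) • w ∈ P.carrier := hball (by simp [abs_of_pos hε]; linarith)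
  have h2 : v + (-(ε / 2)) • w ∈ P.carrier := hball (by simp [abs_of_pos hε]; linarith)
  have h3 : v ∈ openSegment ℝ (v + (ε / 2) • w) (v + (-(ε / 2)) • w) := by
    refine ⟨1 / 2, 1 / 2, by norm_num, by norm_num, by norm_num, ?_⟩
    module
  have h4 := hv.2 h1 h2 h3
  have h5 : (ε / 2) • w = 0 := by simpa using h4
  exact (smul_eq_zero.mp h5).resolve_left (by positivity)

theorem vertices_finite : P.vertices.Finite := by
  have hinj : Function.Injective
      (fun v : P.vertices => {i : Fin P.d | pairing (P.u i) v + P.μ i = 0}) := by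
    intro v w h
    have h0 : (v : E n) + (-1 : ℝ) • (w : E n) = 0 := by
      apply P.eq_zero_of_pairing v
      intro i
      have hi : (i : Fin P.d) ∈ {i : Fin P.d | pairing (P.u i) w + P.μ i = 0} := by
        have : (i : Fin P.d) ∈ {i : Fin P.d | pairing (P.u i) v + P.μ i = 0} := i.2
        simpa only [← h] using this
      have hi' : pairing (P.u i) w + P.μ i = 0 := hi
      rw [pairing_add, pairing_smul]
      linarith [i.2]
    apply Subtype.ext
    rw [neg_one_smul, ← sub_eq_add_neg] at h0
    exact sub_eq_zero.mp h0
  exact Set.finite_coe_iff.mp (Finite.of_injective _ hinj)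

instance : Fintype P.vertices := P.vertices_finite.fintype

theorem card_facetsAt (v : P.vertices) : Fintype.card (P.FacetsAt v) = n := by
  rw [← Nat.card_eq_fintype_card]
  exact P.simple v v.2

theorem exists_dual (v : P.vertices) (i : P.FacetsAt v) :
    ∃ a : E n, ∀ j : P.FacetsAt v, pairing (P.u j) a = if j = i then 1 else 0 := by
  let T : E n →ₗ[ℝ] (P.FacetsAt v → ℝ) :=
    { toFun := fun x j => pairing (P.u j) x
      map_add' := fun x y => funext fun j => pairing_add _ x y
      map_smul' := fun r x => funext fun j => pairing_smul _ r x }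
  have hinj : Function.Injective T := by
    rw [injective_iff_map_eq_zero]
    exact fun w hw => P.eq_zero_of_pairing v w fun j => congrFun hw j
  have hsurj : Function.Surjective T :=
    (LinearMap.injective_iff_surjective_of_finrank_eq_finrank
      (by simp [P.card_facetsAt v])).mp hinj
  obtain ⟨a, ha⟩ := hsurj (fun j => if j = i then 1 else 0)
  exact ⟨a, fun j => congrFun ha j⟩

/-- The edge vectors `α_{i,v}`, `i ∈ I_v`: the basis of `ℝⁿ` dual to the normals `u_j`,
`j ∈ I_v`. -/
def edge (v : P.vertices) (i : P.FacetsAt v) : E n := (P.exists_dual v i).choose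

theorem pairing_edge (v : P.vertices) (i j : P.FacetsAt v) :
    pairing (P.u j) (P.edge v i) = if j = i then 1 else 0 :=
  (P.exists_dual v i).choose_spec j

/-! ### The finite groups `Γ_v` -/

/-- The lattice generated by the normals `u_i`, `i ∈ I_v`. -/
def normalLattice (v : P.vertices) : Submodule ℤ (Fin n → ℤ) :=
  Submodule.span ℤ (Set.range fun i : P.FacetsAt v => P.u i)

/-- The group `Γ_v = ℤⁿ* / ∑ ℤ u_i`. -/
abbrev Gam (v : P.vertices) : Type := (Fin n → ℤ) ⧸ P.normalLattice v

/-- Pairing with a fixed vector, as an additive map on the dual lattice. -/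
def pairingHom (a : E n) : (Fin n → ℤ) →+ ℝ where
  toFun u := pairing u a
  map_zero' := by simp [pairing]
  map_add' u w := by simp [pairing, add_mul, Finset.sum_add_distrib]

theorem linearIndependent_normals (v : P.vertices) :
    LinearIndependent ℤ (fun i : P.FacetsAt v => P.u i) := by
  rw [Fintype.linearIndependent_iff]
  intro g hg i
  have h := congrArg (pairingHom (P.edge v i)) hg
  rw [map_sum, map_zero] at h
  simp only [map_zsmul] at h
  have h2 : ∀ j : P.FacetsAt v, pairingHom (P.edge v i) (P.u j) = if j = i then 1 else 0 :=
    fun j => P.pairing_edge v i j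
  simp only [h2] at h
  simpa using h

instance (v : P.vertices) : Finite (P.Gam v) := by
  apply Submodule.finiteQuotientOfFreeOfRankEq
  rw [normalLattice, finrank_span_eq_card (P.linearIndependent_normals v), P.card_facetsAt v]
  simp

instance (v : P.vertices) : Fintype (P.Gam v) := Fintype.ofFinite _

/-- A representative in `ℤⁿ*` of an element of `Γ_v`. -/
def rep (v : P.vertices) (γ : P.Gam v) : Fin n → ℤ :=
  (Submodule.mkQ_surjective (P.normalLattice v) γ).choose

theorem mk_rep (v : P.vertices) (γ : P.Gam v) : (P.normalLattice v).mkQ (P.rep v γ) = γ :=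
  (Submodule.mkQ_surjective (P.normalLattice v) γ).choose_spec

/-! ### Polarization -/

/-- `ξ` is a polarizing vector: it does not vanish on any edge vector. -/
def IsPolarizing (ξ : Module.Dual ℝ (E n)) : Prop :=
  ∀ (v : P.vertices) (j : P.FacetsAt v), ξ (P.edge v j) ≠ 0

open Classical in
/-- The sign by which polarization changes the edge vector `α_{j,v}`. -/
def flip (ξ : Module.Dual ℝ (E n)) (v : P.vertices) (j : P.FacetsAt v) : ℤ :=
  if ξ (P.edge v j) < 0 then 1 else -1

/-- The polarized edge vector `α♯_{j,v}`. -/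
def pedge (ξ : Module.Dual ℝ (E n)) (v : P.vertices) (j : P.FacetsAt v) : E n :=
  P.flip ξ v j • P.edge v j

/-- The polarized normal `u♯_{j,v}`. -/
def pnormal (ξ : Module.Dual ℝ (E n)) (v : P.vertices) (j : P.FacetsAt v) : Fin n → ℤ :=
  P.flip ξ v j • P.u j

open Classical in
/-- The number `#v` of edge vectors at `v` that are flipped. -/
def numFlips (ξ : Module.Dual ℝ (E n)) (v : P.vertices) : ℕ :=
  (Finset.univ.filter fun j : P.FacetsAt v => 0 < ξ (P.edge v j)).card

/-- The polarized tangent cone `C♯_v = v + ∑ ℝ_{≥ 0} α♯_{j,v}`. -/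
def pcone (ξ : Module.Dual ℝ (E n)) (v : P.vertices) : Set (E n) :=
  {x | ∃ t : P.FacetsAt v → ℝ, (∀ j, 0 ≤ t j) ∧ x = v + ∑ j, t j • P.pedge ξ v j}

/-- The root of unity `λ♯_{γ,j,v} = exp (2πi ⟨γ, α♯_{j,v}⟩)`. -/
def root (ξ : Module.Dual ℝ (E n)) (v : P.vertices) (γ : P.Gam v) (j : P.FacetsAt v) : ℂ :=
  Complex.exp (2 * Real.pi * Complex.I * (pairing (P.rep v γ) (P.pedge ξ v j) : ℝ))

/-- `root` does not depend on the choice of a representative. -/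
theorem root_eq (ξ : Module.Dual ℝ (E n)) (v : P.vertices) (g : Fin n → ℤ) (j : P.FacetsAt v) :
    P.root ξ v ((P.normalLattice v).mkQ g) j =
      Complex.exp (2 * Real.pi * Complex.I * (pairing g (P.pedge ξ v j) : ℝ)) := by
  have hint : ∀ w ∈ P.normalLattice v, ∃ m : ℤ, pairing w (P.pedge ξ v j) = m := by
    intro w hw
    induction hw using Submodule.span_induction with
    | mem w hw =>
      obtain ⟨i, rfl⟩ := hw
      refine ⟨P.flip ξ v j * (if i = j then 1 else 0), ?_⟩
      have h := pairing_smul (P.u i) (P.flip ξ v j : ℝ) (P.edge v j)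
      rw [Int.cast_smul_eq_zsmul] at h
      simp only [pedge]
      rw [h, P.pairing_edge v j i]
      push_cast
      rfl
    | zero => exact ⟨0, by simp [pairing]⟩
    | add x y _ _ hx hy =>
      obtain ⟨a, ha⟩ := hx
      obtain ⟨b, hb⟩ := hy
      refine ⟨a + b, ?_⟩
      have := map_add (pairingHom (P.pedge ξ v j)) x y
      simp only [pairingHom, AddMonoidHom.coe_mk, ZeroHom.coe_mk] at this
      rw [this, ha, hb]
      push_cast
      rfl
    | smul c x _ hx =>
      obtain ⟨a, ha⟩ := hx
      refine ⟨c * a, ?_⟩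
      have := map_zsmul (pairingHom (P.pedge ξ v j)) c x
      simp only [pairingHom, AddMonoidHom.coe_mk, ZeroHom.coe_mk] at this
      rw [this, ha]
      simp
  have hmem : P.rep v ((P.normalLattice v).mkQ g) - g ∈ P.normalLattice v :=
    (Submodule.Quotient.eq _).mp (P.mk_rep v ((P.normalLattice v).mkQ g))
  obtain ⟨m, hm⟩ := hint _ hmem
  have hsub := map_sub (pairingHom (P.pedge ξ v j)) (P.rep v ((P.normalLattice v).mkQ g)) g
  simp only [pairingHom, AddMonoidHom.coe_mk, ZeroHom.coe_mk] at hsub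
  rw [root, Complex.exp_eq_exp_iff_exists_int]
  refine ⟨m, ?_⟩
  have h3 : pairing (P.rep v ((P.normalLattice v).mkQ g)) (P.pedge ξ v j) =
      pairing g (P.pedge ξ v j) + m := by linarith
  rw [h3]
  push_cast
  ring

/-! ### The remainder -/

/-- The polynomial of the differential operator
`∏_{j ∈ I} M^{k,λ_j}(-D_{α_j}) ∏_{j ∉ I} (D_{α_j})^k`
with `α_j = α♯_{j,v}` and `λ_j = λ♯_{γ,j,v}`. -/
def opSymbol (ξ : Module.Dual ℝ (E n)) (k : ℕ) (v : P.vertices) (γ : P.Gam v)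
    (I : Finset (P.FacetsAt v)) : MvPolynomial (Fin n) ℂ :=
  (∏ j ∈ I, Polynomial.aeval (-dirSymbol (P.pedge ξ v j)) (M k (P.root ξ v γ j))) *
    ∏ j ∈ Iᶜ, dirSymbol (P.pedge ξ v j) ^ k

/-- The integrand of the summand of the remainder that belongs to `v`, `γ` and `I`. The factors
`Q (⟨u♯_j, x - v⟩)`, `j ∉ I`, are constant in the directions `α♯_i`, `i ∈ I`, so the
operators `M (-D_{α♯_i})` act on the derivatives of `f` only. -/
def integrand (ξ : Module.Dual ℝ (E n)) (k : ℕ) (f : E n → ℂ) (v : P.vertices) (γ : P.Gam v)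
    (I : Finset (P.FacetsAt v)) (x : E n) : ℂ :=
  (∏ j ∈ Iᶜ, Q (P.root ξ v γ j) k (pairing (P.pnormal ξ v j) (x - v))) *
    diffOp (P.opSymbol ξ k v γ I) f x

/-- All the integrals over polarized tangent cones in the formula for the remainder converge
absolutely. -/
def Converges (ξ : Module.Dual ℝ (E n)) (k : ℕ) (f : E n → ℂ) : Prop :=
  ∀ (v : P.vertices) (γ : P.Gam v), ∀ I ∈ (Finset.univ : Finset (P.FacetsAt v)).ssubsets,
    IntegrableOn (P.integrand ξ k f v γ I) (P.pcone ξ v)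

/-- The remainder `R^Δ_k (f)`, formed with the polarizing vector `ξ`:
a sum over the vertices `v`, the `γ ∈ Γ_v` and the proper subsets `I` of `I_v`. -/
def remainder (ξ : Module.Dual ℝ (E n)) (k : ℕ) (f : E n → ℂ) : ℂ :=
  ∑ v : P.vertices, (-1) ^ P.numFlips ξ v *
    ∑ γ : P.Gam v, ∑ I ∈ (Finset.univ : Finset (P.FacetsAt v)).ssubsets,
      (-1) ^ ((k - 1) * (n - I.card)) * ∫ x in P.pcone ξ v, P.integrand ξ k f v γ I x

end SimpleIntegralPolytope

end PolytopeEM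

end

open PolytopeEM

/-! The remainder is a finite sum of integrals whose integrands are products of bounded functions
with derivatives of `f` of order between `k` and `nk`; everything follows from a pointwise bound on
these integrands.

The periodic factors are bounded (`isPeriodicMeanZero_Q`): `Q_{m,z}` has mean zero over a period, so
its antiderivatives are again periodic, and a continuous periodic function is bounded. The
differential operator is a polynomial in the `∂_l`. As `I` is a proper subset, at least one factor
`(D_α)^k` occurs, so no monomial has degree below `k` (`le_degree_of_mem_support_opSymbol`); each of
the `n` factors has degree at most `k`, so none exceeds `nk` (`degree_le_of_mem_support_opSymbol`).
Hence each integrand is at most `C ∑ |∂^a f|`, the sum being over `k ≤ |a| ≤ nk`. Integration over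
all of `ℝⁿ` gives the estimate. The constant is uniform because `ξ` enters the integrands only
through finitely many sign patterns (`exists_uniform_norm_integrand_le`).

For a symbol of order `N < k - n`, a derivative with `|a| ≥ k` is `O((1 + |x|)^(N - |a|))` with
exponent below `-n`, hence integrable. The same majorant then gives convergence, and convergence
gives linearity. -/

namespace PolytopeEM

/-! ### Boundedness of the periodic functions `Q_{m,z}` -/

/-- The properties of `Q_{m,z}` that are inherited from `m` to `m + 1`. -/
structure IsPeriodicMeanZero (T : ℝ) (q : ℝ → ℂ) : Prop where
  measurable : Measurable q
  periodic : Function.Periodic q T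
  bounded : ∃ C, ∀ x, ‖q x‖ ≤ C
  integral_eq_zero : ∫ x in (0 : ℝ)..T, q x = 0

theorem IsPeriodicMeanZero.intervalIntegrable {T : ℝ} {q : ℝ → ℂ} (hq : IsPeriodicMeanZero T q)
    (a b : ℝ) : IntervalIntegrable q volume a b := by
  obtain ⟨C, hC⟩ := hq.bounded
  exact (intervalIntegrable_const (c := C)).mono_fun hq.measurable.aestronglyMeasurable
    (.of_forall fun x => (hC x).trans (le_abs_self C))

/-- The vanishing mean of `q` makes its antiderivative periodic; continuity then makes it bounded on
one period and so everywhere. The subtracted constant is its mean, which restores mean zero. -/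
theorem IsPeriodicMeanZero.primitive {T : ℝ} {q : ℝ → ℂ} (hq : IsPeriodicMeanZero T q)
    (hT : 0 < T) :
    IsPeriodicMeanZero T (fun x => (∫ t in (0 : ℝ)..x, q t) -
      (1 / (T : ℂ)) * ∫ s in (0 : ℝ)..T, ∫ t in (0 : ℝ)..s, q t) := by
  have hF : Continuous fun x => ∫ t in (0 : ℝ)..x, q t :=
    intervalIntegral.continuous_primitive hq.intervalIntegrable 0
  have hc := hF.sub (continuous_const (y := (1 / (T : ℂ)) *
    ∫ s in (0 : ℝ)..T, ∫ t in (0 : ℝ)..s, q t))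
  have hper : Function.Periodic (fun x => (∫ t in (0 : ℝ)..x, q t) -
      (1 / (T : ℂ)) * ∫ s in (0 : ℝ)..T, ∫ t in (0 : ℝ)..s, q t) T := by
    intro x
    have h := intervalIntegral.integral_add_adjacent_intervals
      (hq.intervalIntegrable 0 x) (hq.intervalIntegrable x (x + T))
    rw [hq.periodic.intervalIntegral_add_eq x 0, zero_add, hq.integral_eq_zero, add_zero] at h
    simp only [h]
  refine ⟨hc.measurable, hper, ?_, ?_⟩
  · obtain ⟨C, hC⟩ := (hper.isBounded_of_continuous hT.ne' hc).exists_norm_le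
    exact ⟨C, fun x => hC _ ⟨x, rfl⟩⟩
  · have hT' : (T : ℂ) ≠ 0 := by exact_mod_cast hT.ne'
    rw [intervalIntegral.integral_sub (hF.intervalIntegrable _ _) intervalIntegrable_const]
    simp [hT']

theorem isPeriodicMeanZero_fract :
    IsPeriodicMeanZero 1 (fun x => ((Int.fract x - 1 / 2 : ℝ) : ℂ)) := by
  refine ⟨?_, fun x => by simp, ⟨2, fun x => ?_⟩, ?_⟩
  · exact Complex.measurable_ofReal.comp (measurable_fract.sub_const _)
  · rw [Complex.norm_real, Real.norm_eq_abs, abs_le]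
    constructor <;> linarith [Int.fract_nonneg x, Int.fract_lt_one x]
  · rw [intervalIntegral.integral_ofReal, intervalIntegral.integral_congr_Ioo_of_le
      (g := fun x : ℝ => x - 1 / 2) zero_le_one
      (fun x hx => by simp [Int.fract_eq_self.mpr ⟨hx.1.le, hx.2⟩]),
      intervalIntegral.integral_sub (by simp) (by simp)]
    norm_num

/-- Translation by `1` multiplies the function by `z` but preserves its integral over a period, so
`(z - 1)` times that integral is zero. -/
theorem isPeriodicMeanZero_zpow_floor {z : ℂ} (hz : IsOfFinOrder z) (hz1 : z ≠ 1) :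
    IsPeriodicMeanZero (orderOf z) (fun x => z / (1 - z) * z ^ ⌊x⌋) := by
  have hz0 : z ≠ 0 := by
    rintro rfl
    obtain ⟨m, hm, h⟩ := isOfFinOrder_iff_pow_eq_one.mp hz
    simp [zero_pow hm.ne'] at h
  have hper : Function.Periodic (fun x : ℝ => z / (1 - z) * z ^ ⌊x⌋) (orderOf z) := by
    intro x
    simp [zpow_add₀ hz0, pow_orderOf_eq_one]
  refine ⟨?_, hper, ⟨‖z / (1 - z)‖, fun x => ?_⟩, ?_⟩
  · exact (measurable_from_top (f := fun m : ℤ => z / (1 - z) * z ^ m)).comp Int.measurable_floor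
  · simp [hz.norm_eq_one]
  · have h1 : ∫ x in (0 : ℝ)..orderOf z, z / (1 - z) * z ^ ⌊x + 1⌋ =
        z * ∫ x in (0 : ℝ)..orderOf z, z / (1 - z) * z ^ ⌊x⌋ := by
      rw [← intervalIntegral.integral_const_mul]
      congr 1
      ext x
      rw [Int.floor_add_one, zpow_add_one₀ hz0]
      ring
    rw [intervalIntegral.integral_comp_add_right (fun x => z / (1 - z) * z ^ ⌊x⌋), zero_add,
      add_comm (orderOf z : ℝ) 1, hper.intervalIntegral_add_eq 1 0, zero_add] at h1
    have h2 : (z - 1) * ∫ x in (0 : ℝ)..orderOf z, z / (1 - z) * z ^ ⌊x⌋ = 0 := by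
      linear_combination -h1
    exact (mul_eq_zero.mp h2).resolve_left (sub_ne_zero.mpr hz1)

theorem isPeriodicMeanZero_Q {z : ℂ} (hz : IsOfFinOrder z) (m : ℕ) :
    IsPeriodicMeanZero (orderOf z) (Q z m) := by
  match m with
  -- The default value at index zero is the zero function, so no lower bound on `m` is needed.
  | 0 => exact ⟨measurable_const, fun _ => rfl, ⟨0, fun x => by simp [Q]⟩, by simp [Q]⟩
  | 1 =>
    by_cases h : z = 1
    · subst h
      simpa [Q] using isPeriodicMeanZero_fract
    · simpa [Q, h] using isPeriodicMeanZero_zpow_floor hz h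
  | m + 2 =>
    have h := (isPeriodicMeanZero_Q hz (m + 1)).primitive (by exact_mod_cast hz.orderOf_pos)
    rw [Complex.ofReal_natCast] at h
    exact h

/-- For fixed `j`, the root is a character of the finite group `Γ_v` evaluated at `γ`, so the order
of `Γ_v` annihilates it. Independence of the representative (`root_eq`) lets powers be computed in
`ℤⁿ*`. -/
theorem SimpleIntegralPolytope.isOfFinOrder_root {n : ℕ} (P : SimpleIntegralPolytope n)
    (ξ : Module.Dual ℝ (E n)) (v : P.vertices) (γ : P.Gam v) (j : P.FacetsAt v) :
    IsOfFinOrder (P.root ξ v γ j) := by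
  have hpow : ∀ (m : ℕ) (g : Fin n → ℤ), P.root ξ v ((P.normalLattice v).mkQ g) j ^ m =
      P.root ξ v ((P.normalLattice v).mkQ (m • g)) j := by
    intro m g
    rw [P.root_eq, P.root_eq, ← Complex.exp_nat_mul]
    have : pairing (m • g) (P.pedge ξ v j) = m * pairing g (P.pedge ξ v j) := by
      simpa [pairingHom] using map_nsmul (pairingHom (P.pedge ξ v j)) m g
    rw [this]
    push_cast
    ring_nf
  obtain ⟨g, rfl⟩ := Submodule.mkQ_surjective _ γ
  rw [isOfFinOrder_iff_pow_eq_one]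
  refine ⟨Nat.card (P.Gam v), Nat.card_pos, ?_⟩
  rw [hpow, map_nsmul, card_nsmul_eq_zero', ← map_zero (P.normalLattice v).mkQ, P.root_eq]
  simp [pairing]

/-! ### The orders of the differential operators -/

variable {n : ℕ}

theorem isHomogeneous_dirSymbol (a : E n) : (dirSymbol a).IsHomogeneous 1 :=
  MvPolynomial.IsHomogeneous.sum _ _ _ fun l _ => by
    simpa using (MvPolynomial.isHomogeneous_C (Fin n) ((a l : ℝ) : ℂ)).mul
      (MvPolynomial.isHomogeneous_X ℂ l)

theorem natDegree_M_le {k : ℕ} (hk : 1 ≤ k) (z : ℂ) : (M k z).natDegree ≤ k := by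
  unfold M
  split_ifs
  · refine Polynomial.natDegree_sum_le_of_forall_le _ _ fun j hj => ?_
    refine (Polynomial.natDegree_C_mul_X_pow_le _ _).trans ?_
    have := Finset.mem_range.mp hj
    omega
  · refine Polynomial.natDegree_add_le_of_degree_le ?_ ?_
    -- The linear term is present for every `k`; this is where `1 ≤ k` is needed.
    · exact (Polynomial.natDegree_C_mul_le _ _).trans (Polynomial.natDegree_X_le.trans hk)
    · refine Polynomial.natDegree_sum_le_of_forall_le _ _ fun j hj => ?_
      exact (Polynomial.natDegree_C_mul_X_pow_le _ _).trans (Finset.mem_Icc.mp hj).2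

theorem totalDegree_aeval_le {σ : Type*} (p : Polynomial ℂ) (q : MvPolynomial σ ℂ)
    (hq : q.totalDegree ≤ 1) : (Polynomial.aeval q p).totalDegree ≤ p.natDegree := by
  rw [Polynomial.aeval_eq_sum_range]
  refine MvPolynomial.totalDegree_finsetSum_le fun i hi => ?_
  refine (MvPolynomial.totalDegree_smul_le _ _).trans ((MvPolynomial.totalDegree_pow _ _).trans ?_)
  have := Finset.mem_range.mp hi
  nlinarith

namespace SimpleIntegralPolytope

variable (P : SimpleIntegralPolytope n)

/-- The factors `M` may contribute constant terms, so only the product over `Iᶜ` counts: it is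
homogeneous of degree `|Iᶜ| k`, and `Iᶜ` is nonempty. -/
theorem le_degree_of_mem_support_opSymbol (ξ : Module.Dual ℝ (E n)) (k : ℕ) (v : P.vertices)
    (γ : P.Gam v) {I : Finset (P.FacetsAt v)} (hI : I ∈ (Finset.univ : Finset _).ssubsets)
    {a : Fin n →₀ ℕ} (ha : a ∈ (P.opSymbol ξ k v γ I).support) : k ≤ ∑ l, a l := by
  classical
  have hhom : (∏ j ∈ Iᶜ, dirSymbol (P.pedge ξ v j) ^ k).IsHomogeneous (∑ j ∈ Iᶜ, 1 * k) :=
    MvPolynomial.IsHomogeneous.prod _ _ _ fun j _ => (isHomogeneous_dirSymbol _).pow k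
  obtain ⟨b, -, c, hc, rfl⟩ := Finset.mem_add.mp (MvPolynomial.support_mul _ _ ha)
  have hdeg : c.degree = ∑ j ∈ Iᶜ, 1 * k := by
    rw [Finsupp.degree_eq_weight_one]
    exact hhom (MvPolynomial.mem_support_iff.mp hc)
  have hne : Iᶜ.Nonempty := by
    rw [Finset.nonempty_iff_ne_empty, Ne, Finset.compl_eq_empty_iff]
    exact (Finset.mem_ssubsets.mp hI).ne
  rw [Finsupp.degree_eq_sum, Finset.sum_const, one_mul,
    smul_eq_mul] at hdeg
  calc k ≤ Iᶜ.card * k := Nat.le_mul_of_pos_left k hne.card_pos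
    _ = ∑ l, c l := hdeg.symm
    _ ≤ ∑ l, (b + c) l := Finset.sum_le_sum fun l _ => Nat.le_add_left _ _

theorem degree_le_of_mem_support_opSymbol (ξ : Module.Dual ℝ (E n)) {k : ℕ} (hk : 1 ≤ k)
    (v : P.vertices) (γ : P.Gam v) (I : Finset (P.FacetsAt v))
    {a : Fin n →₀ ℕ} (ha : a ∈ (P.opSymbol ξ k v γ I).support) : ∑ l, a l ≤ n * k := by
  have hdir : ∀ j, (dirSymbol (P.pedge ξ v j)).totalDegree ≤ 1 :=
    fun j => (isHomogeneous_dirSymbol _).totalDegree_le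
  have h1 : (∏ j ∈ I, Polynomial.aeval (-dirSymbol (P.pedge ξ v j))
      (M k (P.root ξ v γ j))).totalDegree ≤ I.card * k := by
    refine (MvPolynomial.totalDegree_finsetProd _ _).trans (Finset.sum_le_card_nsmul _ _ _ ?_)
    intro j _
    exact (totalDegree_aeval_le _ _ (by rw [MvPolynomial.totalDegree_neg]; exact hdir j)).trans
      (natDegree_M_le hk _)
  have h2 : (∏ j ∈ Iᶜ, dirSymbol (P.pedge ξ v j) ^ k).totalDegree ≤ Iᶜ.card * k := by
    refine (MvPolynomial.totalDegree_finsetProd _ _).trans (Finset.sum_le_card_nsmul _ _ _ ?_)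
    intro j _
    exact (MvPolynomial.totalDegree_pow _ _).trans (by nlinarith [hdir j])
  have h3 := MvPolynomial.le_totalDegree ha
  rw [Finsupp.sum_fintype _ _ fun _ => rfl] at h3
  calc ∑ l, a l ≤ _ := h3
    _ ≤ I.card * k + Iᶜ.card * k := (MvPolynomial.totalDegree_mul _ _).trans (add_le_add h1 h2)
    _ = n * k := by rw [← add_mul, Finset.card_add_card_compl, P.card_facetsAt]

end SimpleIntegralPolytope

/-! ### Partial derivatives -/

theorem partialDeriv_eq_fderiv {f : E n → ℂ} (hf : Differentiable ℝ f) (l : Fin n) :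
    partialDeriv l f = fun x => fderiv ℝ f x (EuclideanSpace.single l 1) :=
  funext fun x => (hf x).lineDeriv_eq_fderiv

theorem contDiff_partialDeriv {m : ℕ} {f : E n → ℂ} (hf : ContDiff ℝ ((m + 1 : ℕ) : WithTop ℕ∞) f)
    (l : Fin n) : ContDiff ℝ (m : WithTop ℕ∞) (partialDeriv l f) := by
  rw [partialDeriv_eq_fderiv (hf.differentiable (by simp))]
  exact (hf.fderiv_right (by push_cast; rfl)).clm_apply contDiff_const

theorem hasCompactSupport_partialDeriv {m : ℕ} {f : E n → ℂ}
    (hf : ContDiff ℝ ((m + 1 : ℕ) : WithTop ℕ∞) f)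
    (hs : HasCompactSupport f) (l : Fin n) : HasCompactSupport (partialDeriv l f) := by
  rw [partialDeriv_eq_fderiv (hf.differentiable (by simp))]
  exact hs.fderiv_apply ℝ _

theorem partialDeriv_linear {m : ℕ} {f g : E n → ℂ}
    (hf : ContDiff ℝ ((m + 1 : ℕ) : WithTop ℕ∞) f) (hg : ContDiff ℝ ((m + 1 : ℕ) : WithTop ℕ∞) g)
    (a b : ℂ) (l : Fin n) :
    partialDeriv l (fun x => a * f x + b * g x) =
      fun x => a * partialDeriv l f x + b * partialDeriv l g x := by
  have hf' := hf.differentiable (by simp)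
  have hg' := hg.differentiable (by simp)
  have h : Differentiable ℝ fun x => a * f x + b * g x :=
    (hf'.const_mul a).add (hg'.const_mul b)
  rw [partialDeriv_eq_fderiv h, partialDeriv_eq_fderiv hf', partialDeriv_eq_fderiv hg']
  funext x
  rw [fderiv_fun_add ((hf' x).const_mul a) ((hg' x).const_mul b),
    fderiv_const_mul (hf' x), fderiv_const_mul (hg' x)]
  simp

/-- An induction principle: a property of functions, indexed by the order of differentiability,
that partial derivatives transport from order `m + 1` to order `m` is transported by
`∂₁^{a₁} ⋯ ∂ₙ^{aₙ}` from order `m + |a|` to order `m`. Pairs of functions are covered by taking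
for `α` a type of tuples. -/
theorem multiDeriv_induction {α : Type*} (D : Fin n → α → α) (p : ℕ → α → Prop)
    (h : ∀ m l f, p (m + 1) f → p m (D l f)) (a : Fin n → ℕ) (m : ℕ) (f : α)
    (hf : p (m + ∑ l, a l) f) :
    p m ((List.finRange n).foldr (fun l g => (D l)^[a l] g) f) := by
  have hiter : ∀ (r : ℕ) (l : Fin n) (m : ℕ) (f : α), p (m + r) f → p m ((D l)^[r] f) := by
    intro r l
    induction r with
    | zero => exact fun m f hf => hf
    | succ r ih =>
      intro m f hf
      rw [Function.iterate_succ_apply]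
      exact ih m _ (h _ l f hf)
  have hlist : ∀ (L : List (Fin n)) (m : ℕ), p (m + (L.map a).sum) f →
      p m (L.foldr (fun l g => (D l)^[a l] g) f) := by
    intro L
    induction L with
    | nil => exact fun m hf => hf
    | cons l L ih =>
      intro m hf
      rw [List.foldr_cons]
      refine hiter _ l m _ (ih _ ?_)
      rwa [List.map_cons, List.sum_cons, ← add_assoc] at hf
  apply hlist
  rwa [← List.ofFn_eq_map, List.sum_ofFn]

theorem contDiff_multiDeriv {m : ℕ} {f : E n → ℂ} (a : Fin n → ℕ)
    (hf : ContDiff ℝ ((m + ∑ l, a l : ℕ) : WithTop ℕ∞) f) :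
    ContDiff ℝ (m : WithTop ℕ∞) (multiDeriv a f) :=
  multiDeriv_induction partialDeriv (fun m f => ContDiff ℝ (m : WithTop ℕ∞) f)
    (fun _ l _ hf => contDiff_partialDeriv hf l) a m f hf

theorem continuous_multiDeriv {f : E n → ℂ} (a : Fin n → ℕ)
    (hf : ContDiff ℝ ((∑ l, a l : ℕ) : WithTop ℕ∞) f) : Continuous (multiDeriv a f) :=
  (contDiff_multiDeriv (m := 0) a (by rwa [zero_add])).continuous

theorem hasCompactSupport_multiDeriv {f : E n → ℂ} (a : Fin n → ℕ)
    (hf : ContDiff ℝ ((∑ l, a l : ℕ) : WithTop ℕ∞) f) (hs : HasCompactSupport f) :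
    HasCompactSupport (multiDeriv a f) :=
  (multiDeriv_induction partialDeriv
    (fun m f => ContDiff ℝ (m : WithTop ℕ∞) f ∧ HasCompactSupport f)
    (fun _ l _ hf => ⟨contDiff_partialDeriv hf.1 l, hasCompactSupport_partialDeriv hf.1 hf.2 l⟩)
    a 0 f ⟨by rwa [zero_add], hs⟩).2

/-- Each partial derivative is linear only on differentiable functions, so smoothness and the linear
relation must be carried along together: the induction runs over the triple `(f, g, a f + b g)`. -/
theorem multiDeriv_linear {f g : E n → ℂ} (c : Fin n → ℕ)
    (hf : ContDiff ℝ ((∑ l, c l : ℕ) : WithTop ℕ∞) f)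
    (hg : ContDiff ℝ ((∑ l, c l : ℕ) : WithTop ℕ∞) g) (a b : ℂ) :
    multiDeriv c (fun x => a * f x + b * g x) =
      fun x => a * multiDeriv c f x + b * multiDeriv c g x := by
  let D : Fin n → (Fin 3 → E n → ℂ) → Fin 3 → E n → ℂ := fun l F i => partialDeriv l (F i)
  let F : Fin 3 → E n → ℂ := ![f, g, fun x => a * f x + b * g x]
  -- Iterated differentiation of a triple acts on each component separately.
  have hcomp : ∀ i, (List.finRange n).foldr (fun l G => (D l)^[c l] G) F i =
      multiDeriv c (F i) := by
    have hiter : ∀ (r : ℕ) (l : Fin n) (G : Fin 3 → E n → ℂ) (i : Fin 3),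
        (D l)^[r] G i = (partialDeriv l)^[r] (G i) := by
      intro r l
      induction r with
      | zero => exact fun _ _ => rfl
      | succ r ih =>
        intro G i
        rw [Function.iterate_succ_apply, Function.iterate_succ_apply, ih]
    intro i
    rw [multiDeriv]
    induction List.finRange n with
    | nil => rfl
    | cons l L ih => rw [List.foldr_cons, List.foldr_cons, hiter, ih]
  have key := multiDeriv_induction D (fun m G => ContDiff ℝ (m : WithTop ℕ∞) (G 0) ∧
    ContDiff ℝ (m : WithTop ℕ∞) (G 1) ∧ G 2 = fun x => a * G 0 x + b * G 1 x)
    (fun m l G hG => ⟨contDiff_partialDeriv hG.1 l, contDiff_partialDeriv hG.2.1 l, by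
      simp only [D, hG.2.2, partialDeriv_linear hG.1 hG.2.1]⟩) c 0 F
    ⟨by rwa [zero_add], by rwa [zero_add], rfl⟩
  simp only [hcomp] at key
  exact key.2.2

theorem diffOp_linear {f g : E n → ℂ} (p : MvPolynomial (Fin n) ℂ) (hf : ContDiff ℝ ∞ f)
    (hg : ContDiff ℝ ∞ g) (a b : ℂ) (x : E n) :
    diffOp p (fun x => a * f x + b * g x) x = a * diffOp p f x + b * diffOp p g x := by
  simp only [diffOp, Finset.mul_sum, ← Finset.sum_add_distrib]
  refine Finset.sum_congr rfl fun c _ => ?_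
  rw [multiDeriv_linear c (hf.of_le (by exact_mod_cast le_top))
    (hg.of_le (by exact_mod_cast le_top))]
  ring

/-! ### Symbols -/

theorem IsSymbol.linear {N : ℝ} {f g : E n → ℂ} (hf : IsSymbol N f) (hg : IsSymbol N g)
    (a b : ℂ) : IsSymbol N (fun x => a * f x + b * g x) := by
  refine ⟨(contDiff_const.mul hf.1).add (contDiff_const.mul hg.1), fun c => ?_⟩
  obtain ⟨A, hA⟩ := hf.2 c
  obtain ⟨B, hB⟩ := hg.2 c
  refine ⟨‖a‖ * A + ‖b‖ * B, fun x => ?_⟩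
  rw [multiDeriv_linear c (hf.1.of_le (by exact_mod_cast le_top))
    (hg.1.of_le (by exact_mod_cast le_top))]
  calc ‖a * multiDeriv c f x + b * multiDeriv c g x‖
      ≤ ‖a‖ * ‖multiDeriv c f x‖ + ‖b‖ * ‖multiDeriv c g x‖ := by
        simpa only [norm_mul] using
          norm_add_le (a * multiDeriv c f x) (b * multiDeriv c g x)
    _ ≤ ‖a‖ * (A * (1 + ‖x‖) ^ (N - ((∑ l, c l : ℕ) : ℝ))) +
        ‖b‖ * (B * (1 + ‖x‖) ^ (N - ((∑ l, c l : ℕ) : ℝ))) := by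
        gcongr
        · exact hA x
        · exact hB x
    _ = _ := by ring

theorem IsSymbol.integrable_multiDeriv {N : ℝ} {f : E n → ℂ} (hf : IsSymbol N f)
    (c : Fin n → ℕ) (hc : N + n < ((∑ l, c l : ℕ) : ℝ)) : Integrable (multiDeriv c f) := by
  obtain ⟨C, hC⟩ := hf.2 c
  have h : Integrable (fun x : E n => (1 + ‖x‖) ^ (-(((∑ l, c l : ℕ) : ℝ) - N))) :=
    integrable_one_add_norm (by simp only [finrank_euclideanSpace_fin]; linarith)
  refine (h.const_mul C).mono' (continuous_multiDeriv c
    (hf.1.of_le (by exact_mod_cast le_top))).aestronglyMeasurable (.of_forall fun x => ?_)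
  simpa only [neg_sub] using hC x

/-- The multi-indices `a` with `k ≤ |a| ≤ n k`. -/
def orders (n k : ℕ) : Finset (Fin n → ℕ) :=
  (Fintype.piFinset fun _ => Finset.range (n * k + 1)).filter
    fun a => k ≤ ∑ l, a l ∧ ∑ l, a l ≤ n * k

theorem mem_orders {k : ℕ} {a : Fin n → ℕ} :
    a ∈ orders n k ↔ k ≤ ∑ l, a l ∧ ∑ l, a l ≤ n * k := by
  refine ⟨fun h => (Finset.mem_filter.mp h).2, fun h => Finset.mem_filter.mpr ⟨?_, h⟩⟩
  rw [Fintype.mem_piFinset]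
  intro l
  have := Finset.single_le_sum (f := a) (fun i _ => Nat.zero_le _) (Finset.mem_univ l)
  exact Finset.mem_range.mpr (by omega)

theorem norm_diffOp_le (p : MvPolynomial (Fin n) ℂ) (s : Finset (Fin n → ℕ))
    (hs : ∀ a ∈ p.support, ⇑a ∈ s) (f : E n → ℂ) (x : E n) :
    ‖diffOp p f x‖ ≤ (∑ a ∈ p.support, ‖p.coeff a‖) * ∑ a ∈ s, ‖multiDeriv a f x‖ := by
  rw [diffOp, Finset.sum_mul]
  refine (norm_sum_le _ _).trans (Finset.sum_le_sum fun a ha => ?_)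
  rw [norm_mul]
  gcongr
  exact Finset.single_le_sum (f := fun a => ‖multiDeriv a f x‖) (fun _ _ => norm_nonneg _)
    (hs a ha)

namespace SimpleIntegralPolytope

variable (P : SimpleIntegralPolytope n)

/-! ### Estimates of the integrands -/

/-- The constant is the product of the bounds for the `Q` factors times the sum of the absolute
values of the coefficients of the operator; neither involves `f`, for which no regularity is
assumed. -/
theorem exists_norm_integrand_le (ξ : Module.Dual ℝ (E n)) {k : ℕ} (hk : 1 ≤ k)
    (v : P.vertices) (γ : P.Gam v) {I : Finset (P.FacetsAt v)}
    (hI : I ∈ (Finset.univ : Finset _).ssubsets) :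
    ∃ C : ℝ≥0, ∀ f x, ‖P.integrand ξ k f v γ I x‖ ≤
      C * ∑ a ∈ orders n k, ‖multiDeriv a f x‖ := by
  choose B hB using fun j => (isPeriodicMeanZero_Q (P.isOfFinOrder_root ξ v γ j) k).bounded
  have hB0 : ∀ j, 0 ≤ B j := fun j => (norm_nonneg _).trans (hB j 0)
  refine ⟨NNReal.mk ((∏ j ∈ Iᶜ, B j) * ∑ a ∈ (P.opSymbol ξ k v γ I).support,
    ‖(P.opSymbol ξ k v γ I).coeff a‖) (mul_nonneg (Finset.prod_nonneg fun j _ => hB0 j)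
      (Finset.sum_nonneg fun _ _ => norm_nonneg _)), fun f x => ?_⟩
  rw [integrand, norm_mul, NNReal.coe_mk, mul_assoc, norm_prod]
  refine mul_le_mul (Finset.prod_le_prod (fun _ _ => norm_nonneg _) fun j _ => hB j _)
    (norm_diffOp_le _ _ (fun a ha => mem_orders.mpr
      ⟨P.le_degree_of_mem_support_opSymbol ξ k v γ hI ha,
        P.degree_le_of_mem_support_opSymbol ξ hk v γ I ha⟩) f x)
    (norm_nonneg _) (Finset.prod_nonneg fun j _ => hB0 j)

/-! ### Uniformity in the polarizing vector -/

theorem integrand_congr {ξ η : Module.Dual ℝ (E n)} (h : P.flip ξ = P.flip η) (k : ℕ)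
    (f : E n → ℂ) (v : P.vertices) (γ : P.Gam v) (I : Finset (P.FacetsAt v)) (x : E n) :
    P.integrand ξ k f v γ I x = P.integrand η k f v γ I x := by
  have h1 : P.pedge ξ v = P.pedge η v := by funext j; rw [pedge, pedge, h]
  have h2 : P.pnormal ξ v = P.pnormal η v := by funext j; rw [pnormal, pnormal, h]
  simp only [integrand, opSymbol, root, h1, h2]

theorem finite_range_flip : (Set.range P.flip).Finite := by
  refine (Set.Finite.pi fun v : P.vertices => Set.Finite.pi fun _ : P.FacetsAt v =>
    Set.toFinite ({1, -1} : Set ℤ)).subset ?_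
  rintro _ ⟨ξ, rfl⟩ v - j -
  rw [flip]
  split_ifs <;> simp

theorem exists_uniform_norm_integrand_le {k : ℕ} (hk : 1 ≤ k) :
    ∃ C : ℝ≥0, ∀ (ξ : Module.Dual ℝ (E n)) (v : P.vertices) (γ : P.Gam v),
      ∀ I ∈ (Finset.univ : Finset (P.FacetsAt v)).ssubsets, ∀ f x,
        ‖P.integrand ξ k f v γ I x‖ ≤ C * ∑ a ∈ orders n k, ‖multiDeriv a f x‖ := by
  have hfixed : ∀ ξ : Module.Dual ℝ (E n), ∃ C : ℝ≥0, ∀ (v : P.vertices) (γ : P.Gam v),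
      ∀ I ∈ (Finset.univ : Finset (P.FacetsAt v)).ssubsets, ∀ f x,
        ‖P.integrand ξ k f v γ I x‖ ≤ C * ∑ a ∈ orders n k, ‖multiDeriv a f x‖ := by
    intro ξ
    choose C hC using fun (v : P.vertices) (γ : P.Gam v)
      (I : {I // I ∈ (Finset.univ : Finset (P.FacetsAt v)).ssubsets}) =>
        P.exists_norm_integrand_le ξ hk v γ I.2
    -- The sum of the nonnegative constants serves as a common upper bound in place of their
    -- maximum.
    refine ⟨∑ v, ∑ γ, ∑ I, C v γ I, fun v γ I hI f x => (hC v γ ⟨I, hI⟩ f x).trans ?_⟩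
    gcongr
    calc C v γ ⟨I, hI⟩ ≤ ∑ I, C v γ I :=
          Finset.single_le_sum (fun _ _ => zero_le) (Finset.mem_univ _)
      _ ≤ ∑ γ, ∑ I, C v γ I :=
          Finset.single_le_sum (f := fun γ => ∑ I, C v γ I) (fun _ _ => zero_le)
            (Finset.mem_univ _)
      _ ≤ ∑ v, ∑ γ, ∑ I, C v γ I :=
          Finset.single_le_sum (f := fun v => ∑ γ, ∑ I, C v γ I) (fun _ _ => zero_le)
            (Finset.mem_univ _)
  choose C hC using hfixed
  have := P.finite_range_flip.fintype
  -- `η ε` is one vector that realizes the sign pattern `ε`; an arbitrary `ξ` has the same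
  -- integrands as the representative of its pattern.
  choose η hη using fun ε : Set.range P.flip => ε.2
  refine ⟨∑ ε, C (η ε), fun ξ v γ I hI f x => ?_⟩
  rw [P.integrand_congr (hη ⟨P.flip ξ, ξ, rfl⟩).symm]
  refine (hC _ v γ I hI f x).trans ?_
  gcongr
  exact Finset.single_le_sum (f := fun ε => C (η ε)) (fun _ _ => zero_le)
    (Finset.mem_univ (⟨P.flip ξ, ξ, rfl⟩ : Set.range P.flip))

/-! ### Convergence, estimate and linearity of the remainder -/

theorem measurable_integrand (ξ : Module.Dual ℝ (E n)) {k : ℕ} (v : P.vertices) (γ : P.Gam v)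
    {I : Finset (P.FacetsAt v)} {f : E n → ℂ}
    (hf : ∀ a ∈ (P.opSymbol ξ k v γ I).support, Continuous (multiDeriv a f)) :
    Measurable (P.integrand ξ k f v γ I) := by
  refine Measurable.mul (Finset.measurable_prod _ fun j _ => ?_) ?_
  · refine (isPeriodicMeanZero_Q (P.isOfFinOrder_root ξ v γ j) k).measurable.comp ?_
    simp only [pairing]
    exact Continuous.measurable (by fun_prop)
  · exact (continuous_finsetSum _ fun a ha => continuous_const.mul (hf a ha)).measurable

theorem converges_of_integrable (ξ : Module.Dual ℝ (E n)) {k : ℕ} (hk : 1 ≤ k) {f : E n → ℂ}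
    (hc : ∀ a ∈ orders n k, Continuous (multiDeriv a f))
    (hi : ∀ a ∈ orders n k, Integrable (multiDeriv a f)) : P.Converges ξ k f := by
  intro v γ I hI
  obtain ⟨C, hC⟩ := P.exists_norm_integrand_le ξ hk v γ hI
  refine Integrable.integrableOn (((integrable_finsetSum _ fun a ha =>
    (hi a ha).norm).const_mul (C : ℝ)).mono' ?_ (.of_forall (hC f)))
  exact (P.measurable_integrand ξ v γ fun a ha => hc a (mem_orders.mpr
      ⟨P.le_degree_of_mem_support_opSymbol ξ k v γ hI ha,
        P.degree_le_of_mem_support_opSymbol ξ hk v γ I ha⟩)).aestronglyMeasurable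

theorem enorm_neg_one_pow (m : ℕ) : ‖(-1 : ℂ) ^ m‖ₑ = 1 := by
  rw [← ofReal_norm, norm_pow]
  simp

/-- Working in `ℝ≥0∞` avoids any integrability assumption. Continuity of the derivatives supplies
the measurability that lets the integral pass through the finite sum. -/
theorem exists_enorm_remainder_le {k : ℕ} (hk : 1 ≤ k) :
    ∃ K : ℝ≥0, ∀ (ξ : Module.Dual ℝ (E n)) (f : E n → ℂ),
      (∀ a ∈ orders n k, Continuous (multiDeriv a f)) →
      ‖P.remainder ξ k f‖ₑ ≤ K * ⨆ (j : Fin n → ℕ) (_ : k ≤ ∑ l, j l) (_ : ∑ l, j l ≤ n * k),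
        eLpNorm (multiDeriv j f) 1 volume := by
  obtain ⟨C, hC⟩ := P.exists_uniform_norm_integrand_le hk
  let m : ℕ := ∑ v : P.vertices, ∑ _γ : P.Gam v,
    (Finset.univ : Finset (P.FacetsAt v)).ssubsets.card
  -- `m` counts the triples `(v, γ, I)`; the factor `(orders n k).card` comes from replacing a sum
  -- of `L¹` norms by their supremum.
  refine ⟨m * (C * (orders n k).card), fun ξ f hc => ?_⟩
  set S := ⨆ (j : Fin n → ℕ) (_ : k ≤ ∑ l, j l) (_ : ∑ l, j l ≤ n * k),
        eLpNorm (multiDeriv j f) 1 volume with hS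
  have hterm : ∀ (v : P.vertices) (γ : P.Gam v),
      ∀ I ∈ (Finset.univ : Finset (P.FacetsAt v)).ssubsets,
        ‖∫ x in P.pcone ξ v, P.integrand ξ k f v γ I x‖ₑ ≤ C * (orders n k).card * S := by
    intro v γ I hI
    calc ‖∫ x in P.pcone ξ v, P.integrand ξ k f v γ I x‖ₑ
        ≤ ∫⁻ x in P.pcone ξ v, ‖P.integrand ξ k f v γ I x‖ₑ := enorm_integral_le_lintegral_enorm _
      -- Enlarging the cone to all of `ℝⁿ` removes its geometry from the estimate.
      _ ≤ ∫⁻ x, ‖P.integrand ξ k f v γ I x‖ₑ := setLIntegral_le_lintegral _ _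
      _ ≤ ∫⁻ x, C * ∑ a ∈ orders n k, ‖multiDeriv a f x‖ₑ := by
          refine lintegral_mono fun x => ?_
          have h : ‖P.integrand ξ k f v γ I x‖₊ ≤ C * ∑ a ∈ orders n k, ‖multiDeriv a f x‖₊ := by
            rw [← NNReal.coe_le_coe]
            push_cast
            exact hC ξ v γ I hI f x
          simp only [enorm_eq_nnnorm]
          exact_mod_cast h
      _ = C * ∑ a ∈ orders n k, eLpNorm (multiDeriv a f) 1 volume := by
          rw [lintegral_const_mul' _ _ ENNReal.coe_ne_top,
            lintegral_finsetSum _ fun a ha => (hc a ha).measurable.enorm]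
          simp only [eLpNorm_one_eq_lintegral_enorm]
      _ ≤ C * ∑ _a ∈ orders n k, S := by
          gcongr with a ha
          rw [hS]
          exact le_iSup_of_le a (le_iSup_of_le (mem_orders.mp ha).1
            (le_iSup_of_le (mem_orders.mp ha).2 le_rfl))
      _ = C * (orders n k).card * S := by
          rw [Finset.sum_const, nsmul_eq_mul, mul_assoc]
  calc ‖P.remainder ξ k f‖ₑ
      ≤ ∑ v : P.vertices, ∑ γ : P.Gam v,
          ∑ I ∈ (Finset.univ : Finset (P.FacetsAt v)).ssubsets,
            ‖∫ x in P.pcone ξ v, P.integrand ξ k f v γ I x‖ₑ := by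
        refine (enorm_sum_le _ _).trans (Finset.sum_le_sum fun v _ => ?_)
        rw [enorm_mul, enorm_neg_one_pow, one_mul]
        refine (enorm_sum_le _ _).trans (Finset.sum_le_sum fun γ _ => ?_)
        refine (enorm_sum_le _ _).trans (Finset.sum_le_sum fun I _ => ?_)
        rw [enorm_mul, enorm_neg_one_pow, one_mul]
    _ ≤ ∑ v : P.vertices, ∑ _γ : P.Gam v,
          ∑ _I ∈ (Finset.univ : Finset (P.FacetsAt v)).ssubsets, C * (orders n k).card * S :=
        Finset.sum_le_sum fun v _ => Finset.sum_le_sum fun γ _ => Finset.sum_le_sum fun I hI =>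
          hterm v γ I hI
    _ = _ := by
        simp only [m, Finset.sum_const, nsmul_eq_mul]
        push_cast
        simp only [Finset.sum_mul, mul_assoc]

theorem remainder_linear (ξ : Module.Dual ℝ (E n)) {k : ℕ} {f g : E n → ℂ}
    (hf : ContDiff ℝ ∞ f) (hg : ContDiff ℝ ∞ g) (hfc : P.Converges ξ k f)
    (hgc : P.Converges ξ k g) (a b : ℂ) :
    P.remainder ξ k (fun x => a * f x + b * g x) =
      a * P.remainder ξ k f + b * P.remainder ξ k g := by
  simp only [remainder, Finset.mul_sum, ← Finset.sum_add_distrib]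
  refine Finset.sum_congr rfl fun v _ => Finset.sum_congr rfl fun γ _ =>
    Finset.sum_congr rfl fun I hI => ?_
  have h : P.integrand ξ k (fun x => a * f x + b * g x) v γ I = fun x =>
      a * P.integrand ξ k f v γ I x + b * P.integrand ξ k g v γ I x := by
    funext x
    rw [integrand, diffOp_linear _ hf hg, integrand, integrand]
    ring
  -- Absolute convergence for `f` and `g` is what permits splitting the integral.
  rw [h, integral_add ((hfc v γ I hI).const_mul a) ((hgc v γ I hI).const_mul b),
    integral_const_mul, integral_const_mul]
  ring

end SimpleIntegralPolytope

end PolytopeEM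

theorem proposition7p1 {n : ℕ} (P : SimpleIntegralPolytope n) (k : ℕ) (hk : 1 ≤ k) :
    ∃ K : ℝ≥0, ∀ ξ : Module.Dual ℝ (E n), P.IsPolarizing ξ →
      -- on compactly supported functions of type `C^{nk}`
      (∀ f : E n → ℂ, ContDiff ℝ ((n * k : ℕ) : WithTop ℕ∞) f → HasCompactSupport f →
        P.Converges ξ k f ∧
        ‖P.remainder ξ k f‖ₑ ≤ K * ⨆ (j : Fin n → ℕ) (_ : k ≤ ∑ l, j l) (_ : ∑ l, j l ≤ n * k),
          eLpNorm (multiDeriv j f) 1 volume) ∧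
      -- on symbols of order less than `k - n`
      (∀ N : ℝ, N < (k : ℝ) - n → ∀ f : E n → ℂ, IsSymbol N f →
        P.Converges ξ k f ∧
        (∀ j : Fin n → ℕ, k ≤ ∑ l, j l → ∑ l, j l ≤ n * k → Integrable (multiDeriv j f)) ∧
        ‖P.remainder ξ k f‖ₑ ≤ K * ⨆ (j : Fin n → ℕ) (_ : k ≤ ∑ l, j l) (_ : ∑ l, j l ≤ n * k),
          eLpNorm (multiDeriv j f) 1 volume) ∧
      -- linearity on symbols of order less than `k - n`
      (∀ N : ℝ, N < (k : ℝ) - n → ∀ f g : E n → ℂ, IsSymbol N f → IsSymbol N g → ∀ a b : ℂ,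
        IsSymbol N (fun x => a * f x + b * g x) ∧
        P.remainder ξ k (fun x => a * f x + b * g x) =
          a * P.remainder ξ k f + b * P.remainder ξ k g) := by
  obtain ⟨K, hK⟩ := P.exists_enorm_remainder_le hk
  have hcont : ∀ f : E n → ℂ, ContDiff ℝ ((n * k : ℕ) : WithTop ℕ∞) f →
      ∀ a ∈ orders n k, Continuous (multiDeriv a f) := fun f hf a ha =>
    continuous_multiDeriv a (hf.of_le (by exact_mod_cast (mem_orders.mp ha).2))
  have hsmooth : ∀ {N : ℝ} {f : E n → ℂ}, IsSymbol N f →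
      ContDiff ℝ ((n * k : ℕ) : WithTop ℕ∞) f :=
    fun hf => hf.1.of_le (by exact_mod_cast le_top)
  have hint : ∀ {N : ℝ} {f : E n → ℂ}, N < (k : ℝ) - n → IsSymbol N f →
      ∀ a ∈ orders n k, Integrable (multiDeriv a f) := by
    intro N f hN hf a ha
    -- The lowest order `|a| = k` decays least, and there `N - k < -n` is exactly the hypothesis on
    -- `N`.
    have : (k : ℝ) ≤ ((∑ l, a l : ℕ) : ℝ) := by exact_mod_cast (mem_orders.mp ha).1
    exact hf.integrable_multiDeriv a (by linarith)
  have hconv : ∀ (ξ : Module.Dual ℝ (E n)) {N : ℝ} {f : E n → ℂ}, N < (k : ℝ) - n →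
      IsSymbol N f → P.Converges ξ k f := fun ξ _ f hN hf =>
    P.converges_of_integrable ξ hk (hcont f (hsmooth hf)) (hint hN hf)
  refine ⟨K, fun ξ _ => ⟨fun f hf hs => ⟨?_, hK ξ f (hcont f hf)⟩, fun N hN f hf =>
    ⟨hconv ξ hN hf, fun j h1 h2 => hint hN hf j (mem_orders.mpr ⟨h1, h2⟩),
      hK ξ f (hcont f (hsmooth hf))⟩, fun N hN f g hf hg a b => ⟨hf.linear hg a b,
      P.remainder_linear ξ hf.1 hg.1 (hconv ξ hN hf) (hconv ξ hN hg) a b⟩⟩⟩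
  refine P.converges_of_integrable ξ hk (hcont f hf) fun a ha => ?_
  exact (hcont f hf a ha).integrable_of_hasCompactSupport (hasCompactSupport_multiDeriv a
    (hf.of_le (by exact_mod_cast (mem_orders.mp ha).2)) hs)
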